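/- For a graph $H$ with $m$ vertices and $e$ edges and for $r\ge 1$, let $rb_r(H;n)$ be the maximum, over all colorings of the edges of $K_n$ with $r$ colors, of the number of rainbow copies of $H$ in $K_n$ (subgraphs of $K_n$ isomorphic to $H$ whose edges have pairwise distinct colors), and let \[ rbC_r(H;n)=\frac{rb_r(H;n)}{\binom{n}{m}\frac{m!}{|\mathrm{Aut}(H)|}},\qquad rbC_r(H)=\lim_{n\to\infty} rbC_r(H;n). \] Call $H$ $r$-anti-common if $rbC_r(H)=\binom{r}{e}\,e!/r^{e}$, and anti-common if it is $r$-anti-common for every $r\ge m$. Let $G_m$ be chosen uniformly at random among all bipartite graphs on the labelled vertex set $\{1,\dots,m\}$, and let $e(G_m)$ be its number of edges. Then, as $m\to\infty$, \[ \Pr\bigl[e(G_m)>m\sqrt{m-1}\bigr]\to 1 \qquad\text{and}\qquad \Pr\bigl[G_m \text{ is not anti-common}\bigr]\to 1 . \] That is, almost all bipartite graphs have more than $m\sqrt{m-1}$ edges, where $m$ is the number of vertices, and almost all bipartite graphs are not anti-common. -/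

import Mathlib

open Filter Topology
open scoped Nat

namespace AntiRamsey

/-- The number of rainbow copies of `H` in the complete graph on `Fin n`, whose edges are
coloured by `c`. A copy of `H` is a subgraph isomorphic to `H`; it is rainbow if distinct edges
of it have distinct colours. -/
noncomputable def rainbowCount {V : Type*} (H : SimpleGraph V) {n r : ℕ}
    (c : SimpleGraph.TopEdgeLabeling (Fin n) (Fin r)) : ℕ :=
  Set.ncard {S : (⊤ : SimpleGraph (Fin n)).Subgraph |
    Nonempty (S.coe ≃g H) ∧
      ∀ e f : (⊤ : SimpleGraph (Fin n)).edgeSet,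
        e.1 ∈ S.edgeSet → f.1 ∈ S.edgeSet → e ≠ f → c e ≠ c f}

/-- The anti-Ramsey multiplicity `rb_r(H; n)`: the maximum number of rainbow copies of `H` over
the (finitely many) `r`-edge-colourings of the complete graph on `n` vertices. -/
noncomputable def rb {V : Type*} (r : ℕ) (H : SimpleGraph V) (n : ℕ) : ℕ :=
  ⨆ c : SimpleGraph.TopEdgeLabeling (Fin n) (Fin r), rainbowCount H c

/-- The ratio `rbC_r(H; n)` of `rb_r(H; n)` to the number `binom(n, m) * m! / |Aut H|` of copies
of `H` in the complete graph on `n` vertices, where `m` is the number of vertices of `H`. -/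
noncomputable def rbC {V : Type*} (r : ℕ) (H : SimpleGraph V) (n : ℕ) : ℝ :=
  (rb r H n : ℝ) /
    ((n.choose (Nat.card V) : ℝ) * (((Nat.card V)! : ℝ) / (Nat.card (H ≃g H) : ℝ)))

/-- `H` with `e` edges is `r`-anti-common if the limit of `rbC_r(H; n)` as `n → ∞` is
`binom(r, e) * e! / r ^ e`. (That limit always exists: for `n ≥ m` the ratio is nonincreasing
in `n` and nonnegative.) -/
def IsAntiCommonWith {V : Type*} (r : ℕ) (H : SimpleGraph V) : Prop :=
  Tendsto (fun n : ℕ => rbC r H n) atTop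
    (𝓝 ((r.choose H.edgeSet.ncard : ℝ) * ((H.edgeSet.ncard)! : ℝ) / (r : ℝ) ^ H.edgeSet.ncard))

/-- `H` is anti-common if it is `r`-anti-common for every `r` at least its number of vertices. -/
def IsAntiCommon {V : Type*} (H : SimpleGraph V) : Prop :=
  ∀ r : ℕ, Nat.card V ≤ r → IsAntiCommonWith r H

/-- The probability that a uniformly random bipartite graph on the labelled vertex set `Fin m`
has property `P`. -/
noncomputable def bipartiteProb (m : ℕ) (P : SimpleGraph (Fin m) → Prop) : ℝ :=
  (Set.ncard {G : SimpleGraph (Fin m) | G.IsBipartite ∧ P G} : ℝ) /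
    (Set.ncard {G : SimpleGraph (Fin m) | G.IsBipartite} : ℝ)

end AntiRamsey

namespace AntiRamsey

/-! One explicit colouring beats the random one. Split `m * t` vertices into `m` parts and colour
each edge by its pair of parts, using `r = m(m+1)/2` colours. The `t ^ m` transversal copies of `H`
are all rainbow, so the density is at least `m ^ (-m)` for every `t > 0` (`inv_pow_le_rbC`). The
anti-common value is at most `exp (-e(e-1)/(m(m+1)))`, which is smaller once `e(e-1) > m²(m+1) log
m`.

Almost all bipartite graphs have more than `m²/32` edges, far above both thresholds: there are at
least `2 ^ ((m²-1)/4)` bipartite graphs, but at most `2 ^ (11m²/48)` graphs with no more than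
`m²/32` edges. -/

/-- The colouring of the edges of the complete graph on `Fin (m * t)`, split into `m` parts of size
`t`, in which the colour of an edge records the two parts containing its endpoints. -/
noncomputable def partColoring (m t : ℕ) :
    SimpleGraph.TopEdgeLabeling (Fin (m * t)) (Fin (Fintype.card (Sym2 (Fin m)))) :=
  fun e => Fintype.equivFin (Sym2 (Fin m)) (e.1.map fun x => (finProdFinEquiv.symm x).1)

/-- The copy of a graph `H` on `Fin m` in the complete graph on `Fin (m * t)` which uses exactly
one vertex from each of the `m` parts, namely the one selected by `f`. -/
def transversalCopy {m t : ℕ} (H : SimpleGraph (Fin m)) (f : Fin m → Fin t) :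
    SimpleGraph.Copy H (⊤ : SimpleGraph (Fin (m * t))) where
  toHom :=
    { toFun := fun i => finProdFinEquiv (i, f i)
      map_rel' := by
        intro i j hij
        simpa using fun h => absurd h hij.ne }
  injective' := by
    intro i j hij
    have := finProdFinEquiv.injective hij
    exact (Prod.ext_iff.1 this).1

theorem transversalCopy_apply {m t : ℕ} (H : SimpleGraph (Fin m)) (f : Fin m → Fin t) (i : Fin m) :
    (transversalCopy H f).toHom i = finProdFinEquiv (i, f i) := rfl

theorem toSubgraph_transversalCopy_injective {m t : ℕ} (H : SimpleGraph (Fin m)) :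
    Function.Injective fun f : Fin m → Fin t => (transversalCopy H f).toSubgraph := by
  intro f g hfg
  have hv := congrArg SimpleGraph.Subgraph.verts hfg
  funext i
  have hi : finProdFinEquiv (i, f i) ∈ (transversalCopy H g).toSubgraph.verts := by
    rw [← hv]
    exact ⟨i, trivial, rfl⟩
  obtain ⟨j, -, hj⟩ := hi
  rw [transversalCopy_apply] at hj
  have h := Prod.ext_iff.1 (finProdFinEquiv.injective hj)
  obtain rfl : j = i := h.1
  exact h.2.symm

/-- Inside a transversal copy the colour determines the edge; hence the copy is rainbow. -/
theorem partColoring_of_mem_edgeSet {m t : ℕ} (H : SimpleGraph (Fin m)) (f : Fin m → Fin t)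
    (e : (⊤ : SimpleGraph (Fin (m * t))).edgeSet)
    (he : e.1 ∈ (transversalCopy H f).toSubgraph.edgeSet) :
    ((Fintype.equivFin (Sym2 (Fin m))).symm (partColoring m t e)).map
      (fun i => finProdFinEquiv (i, f i)) = e.1 := by
  obtain ⟨e, he'⟩ := e
  induction e with
  | _ x y =>
    obtain ⟨i, j, -, rfl, rfl⟩ := he
    simp only [transversalCopy_apply, partColoring, Equiv.symm_apply_apply, Sym2.map_mk]

theorem pow_le_rainbowCount_partColoring {m : ℕ} (t : ℕ) (H : SimpleGraph (Fin m)) :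
    t ^ m ≤ rainbowCount H (partColoring m t) := by
  have h := Set.ncard_le_ncard_of_injOn (s := (Set.univ : Set (Fin m → Fin t)))
    (t := {S : (⊤ : SimpleGraph (Fin (m * t))).Subgraph |
      Nonempty (S.coe ≃g H) ∧
      ∀ e f : (⊤ : SimpleGraph (Fin (m * t))).edgeSet,
        e.1 ∈ S.edgeSet → f.1 ∈ S.edgeSet → e ≠ f →
          partColoring m t e ≠ partColoring m t f})
    (fun f => (transversalCopy H f).toSubgraph) ?_
    (toSubgraph_transversalCopy_injective H).injOn
  · rw [Set.ncard_univ, Nat.card_eq_fintype_card, Fintype.card_fun, Fintype.card_fin,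
      Fintype.card_fin] at h
    exact h
  · rintro f -
    refine ⟨⟨(transversalCopy H f).isoToSubgraph.symm⟩, fun e e' he he' hne hc => hne ?_⟩
    apply Subtype.ext
    rw [← partColoring_of_mem_edgeSet H f e he, ← partColoring_of_mem_edgeSet H f e' he', hc]

theorem rainbowCount_le_rb {V : Type*} (H : SimpleGraph V) {n r : ℕ}
    (c : SimpleGraph.TopEdgeLabeling (Fin n) (Fin r)) : rainbowCount H c ≤ rb r H n := by
  have : Finite (SimpleGraph.TopEdgeLabeling (Fin n) (Fin r)) :=
    inferInstanceAs (Finite ((⊤ : SimpleGraph (Fin n)).edgeSet → Fin r))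
  exact le_ciSup (Set.finite_range _).bddAbove c

theorem inv_pow_le_rbC {m t : ℕ} (ht : 0 < t) (H : SimpleGraph (Fin m)) :
    ((m : ℝ) ^ m)⁻¹ ≤ rbC (Fintype.card (Sym2 (Fin m))) H (m * t) := by
  have hrb : (t : ℝ) ^ m ≤ (rb (Fintype.card (Sym2 (Fin m))) H (m * t) : ℝ) := by
    exact_mod_cast (pow_le_rainbowCount_partColoring t H).trans (rainbowCount_le_rb H _)
  have : Finite (H ≃g H) := Finite.of_injective (fun f => (f : Fin m → Fin m)) DFunLike.coe_injective
  have haut : (1 : ℝ) ≤ (Nat.card (H ≃g H) : ℝ) := by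
    have : Nonempty (H ≃g H) := ⟨SimpleGraph.Iso.refl⟩
    exact_mod_cast Nat.card_pos (α := H ≃g H)
  have hfac : (0 : ℝ) < (m ! : ℝ) := by exact_mod_cast m.factorial_pos
  have hchoose : (0 : ℝ) < ((m * t).choose m : ℝ) := by
    exact_mod_cast Nat.choose_pos (Nat.le_mul_of_pos_right m ht)
  have hden : ((m * t).choose m : ℝ) * ((m ! : ℝ) / (Nat.card (H ≃g H) : ℝ)) ≤
      (m : ℝ) ^ m * (t : ℝ) ^ m := by
    calc _ ≤ ((m * t).choose m : ℝ) * (m ! : ℝ) := by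
          gcongr
          exact div_le_self hfac.le haut
      _ ≤ ((m * t : ℕ) : ℝ) ^ m / (m ! : ℝ) * (m ! : ℝ) := by
          gcongr
          exact Nat.choose_le_pow_div m (m * t)
      _ = (m : ℝ) ^ m * (t : ℝ) ^ m := by
          rw [div_mul_cancel₀ _ hfac.ne', Nat.cast_mul, mul_pow]
  have htm : (0 : ℝ) < (t : ℝ) ^ m := by positivity
  have hmm : (0 : ℝ) < (m : ℝ) ^ m := by
    rcases Nat.eq_zero_or_pos m with rfl | h <;> [simp; positivity]
  unfold rbC
  rw [Nat.card_fin, le_div_iff₀ (by positivity)]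
  refine le_trans ?_ hrb
  rw [inv_mul_le_iff₀ hmm]
  exact hden

/-! ### Comparison with the anti-common value -/

/-- The left side is the product of `1 - i/r` over `i < e`, and each factor is at most `exp (-i/r)`.
-/
theorem choose_mul_factorial_div_pow_le (r e : ℕ) :
    (r.choose e : ℝ) * (e ! : ℝ) / (r : ℝ) ^ e ≤
      Real.exp (-((e : ℝ) * ((e : ℝ) - 1) / (2 * r))) := by
  have hsum : ∑ i ∈ Finset.range e, (i : ℝ) = (e : ℝ) * ((e : ℝ) - 1) / 2 := by
    induction e with
    | zero => simp
    | succ k ih => rw [Finset.sum_range_succ, ih]; push_cast; ring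
  have hprod : (r.choose e : ℝ) * (e ! : ℝ) / (r : ℝ) ^ e =
      ∏ i ∈ Finset.range e, (((r - i : ℕ) : ℝ) / r) := by
    rw [Finset.prod_div_distrib, Finset.prod_const, Finset.card_range, ← Nat.cast_prod,
      ← Nat.descFactorial_eq_prod_range, Nat.descFactorial_eq_factorial_mul_choose]
    push_cast
    ring
  have hexp : Real.exp (-((e : ℝ) * ((e : ℝ) - 1) / (2 * r))) =
      ∏ i ∈ Finset.range e, Real.exp (-((i : ℝ) / r)) := by
    rw [← Real.exp_sum, Finset.sum_neg_distrib, ← Finset.sum_div, hsum, div_div]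
  rw [hprod, hexp]
  refine Finset.prod_le_prod (fun i _ => by positivity) fun i _ => ?_
  -- For `i ≥ r` truncated subtraction makes the factor zero.
  rcases le_total r i with h | h
  · rw [Nat.sub_eq_zero_of_le h]
    simpa using (Real.exp_pos _).le
  rcases Nat.eq_zero_or_pos r with rfl | hr
  · simp
  have hr' : (0 : ℝ) < r := by exact_mod_cast hr
  rw [Nat.cast_sub h, sub_div, div_self hr'.ne']
  linarith [Real.add_one_le_exp (-((i : ℝ) / r))]

/-- A graph whose number of edges is of larger order than `m * sqrt (m * log m)`, where `m` is its
number of vertices, is not anti-common. -/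
theorem not_isAntiCommon_of_lt {m : ℕ} (hm : 0 < m) (H : SimpleGraph (Fin m))
    (h : (m : ℝ) ^ 2 * ((m : ℝ) + 1) * Real.log m <
      (H.edgeSet.ncard : ℝ) * ((H.edgeSet.ncard : ℝ) - 1)) : ¬ IsAntiCommon H := by
  intro hH
  have hm' : (0 : ℝ) < m := by exact_mod_cast hm
  have hcard : Fintype.card (Sym2 (Fin m)) = (m + 1).choose 2 := by
    rw [Sym2.card, Fintype.card_fin]
  have hr : (2 * Fintype.card (Sym2 (Fin m)) : ℝ) = m * (m + 1) := by
    rw [hcard, Nat.cast_choose_two]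
    push_cast
    ring
  have hle : m ≤ Fintype.card (Sym2 (Fin m)) := by
    have : (2 * m : ℝ) ≤ 2 * Fintype.card (Sym2 (Fin m)) := by
      have : (1 : ℝ) ≤ m := by exact_mod_cast hm
      rw [hr]
      nlinarith
    exact_mod_cast le_of_mul_le_mul_left this two_pos
  have hlim := hH (Fintype.card (Sym2 (Fin m))) (by rwa [Nat.card_fin])
  -- The assumed limit may be tested along multiples of `m` alone.
  have hsub : Tendsto (fun t : ℕ => m * t) atTop atTop :=
    tendsto_id.const_mul_atTop' hm
  have hge := ge_of_tendsto (hlim.comp hsub)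
    ((eventually_gt_atTop 0).mono fun t ht => inv_pow_le_rbC ht H)
  have hlog : ((m : ℝ) ^ m)⁻¹ = Real.exp (-(m * Real.log m)) := by
    rw [Real.exp_neg, Real.exp_nat_mul, Real.exp_log hm']
  have hcmp := hge.trans (choose_mul_factorial_div_pow_le _ _)
  rw [hlog, Real.exp_le_exp, neg_le_neg_iff, hr, div_le_iff₀ (by positivity)] at hcmp
  linarith

/-! ### Counting sparse graphs and bipartite graphs -/

/-- Few graphs on `Fin m` have at most `m ^ 2 / 32` edges. -/
theorem ncard_sparse_le (m : ℕ) :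
    (Set.ncard {G : SimpleGraph (Fin m) | (G.edgeSet.ncard : ℝ) ≤ (m : ℝ) ^ 2 / 32} : ℝ) ≤
      Real.exp (Real.log 2 * (11 / 48 * (m : ℝ) ^ 2)) := by
  classical
  set B : Set (SimpleGraph (Fin m)) := {G | (G.edgeSet.ncard : ℝ) ≤ (m : ℝ) ^ 2 / 32}
  have hlog2 : 0 < Real.log 2 := Real.log_pos one_lt_two
  have hlog54 : Real.log (5 / 4) ≤ Real.log 2 / 3 := by
    have h : Real.log ((5 / 4 : ℝ) ^ 3) ≤ Real.log 2 :=
      Real.log_le_log (by norm_num) (by norm_num)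
    rw [Real.log_pow] at h
    push_cast at h
    linarith
  have hlog4 : Real.log (1 / 4) = -(2 * Real.log 2) := by
    rw [one_div, Real.log_inv, show (4 : ℝ) = 2 ^ 2 by norm_num, Real.log_pow]
    norm_num
  -- Markov-type bound: weight each graph by `(1/4) ^ e`. The total is controlled by the binomial
  -- theorem, while a sparse graph weighs at least `2 ^ (-m²/16)`. The final exponent is `1/16 + 1/6
  -- = 11/48`.
  have htotal : ∑ G : SimpleGraph (Fin m), (1 / 4 : ℝ) ^ G.edgeFinset.card ≤
      (5 / 4 : ℝ) ^ (m.choose 2) := by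
    have hinj : Set.InjOn (fun G : SimpleGraph (Fin m) => G.edgeFinset)
        (Finset.univ : Finset (SimpleGraph (Fin m))) := fun G _ G' _ h =>
      SimpleGraph.edgeFinset_inj.1 h
    rw [← Finset.sum_image (f := fun s : Finset (Sym2 (Fin m)) => (1 / 4 : ℝ) ^ s.card) hinj]
    refine (Finset.sum_le_sum_of_subset_of_nonneg
      (t := (⊤ : SimpleGraph (Fin m)).edgeFinset.powerset) ?_ fun _ _ _ => by positivity).trans ?_
    · intro s hs
      obtain ⟨G, -, rfl⟩ := Finset.mem_image.1 hs
      exact Finset.mem_powerset.2 (SimpleGraph.edgeFinset_mono le_top)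
    · have h := Finset.sum_pow_mul_eq_add_pow (1 / 4 : ℝ) 1 (⊤ : SimpleGraph (Fin m)).edgeFinset
      simp only [one_pow, mul_one] at h
      rw [h, SimpleGraph.card_edgeFinset_top_eq_card_choose_two, Fintype.card_fin]
      norm_num
  have hsparse : (B.ncard : ℝ) * Real.exp (-(Real.log 2 * ((m : ℝ) ^ 2 / 16))) ≤
      ∑ G : SimpleGraph (Fin m), (1 / 4 : ℝ) ^ G.edgeFinset.card := by
    rw [Set.ncard_eq_toFinset_card', ← nsmul_eq_mul]
    refine (Finset.card_nsmul_le_sum _ (fun G => (1 / 4 : ℝ) ^ G.edgeFinset.card) _ ?_).trans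
      (Finset.sum_le_sum_of_subset_of_nonneg (Finset.subset_univ _) fun _ _ _ => by positivity)
    intro G hG
    have hG' : (G.edgeSet.ncard : ℝ) ≤ (m : ℝ) ^ 2 / 32 := by simpa [B] using hG
    rw [Set.ncard_eq_toFinset_card'] at hG'
    change ((G.edgeFinset.card : ℕ) : ℝ) ≤ _ at hG'
    rw [← Real.exp_log (show (0 : ℝ) < 1 / 4 by norm_num), ← Real.exp_nat_mul, Real.exp_le_exp,
      hlog4]
    nlinarith
  have hpow : (5 / 4 : ℝ) ^ (m.choose 2) ≤ Real.exp (Real.log 2 * ((m : ℝ) ^ 2 / 6)) := by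
    rw [← Real.exp_log (show (0 : ℝ) < 5 / 4 by norm_num), ← Real.exp_nat_mul, Real.exp_le_exp,
      Nat.cast_choose_two]
    have hc : (m : ℝ) * ((m : ℝ) - 1) / 2 ≤ (m : ℝ) ^ 2 / 2 := by nlinarith [m.cast_nonneg (α := ℝ)]
    calc _ ≤ (m : ℝ) ^ 2 / 2 * Real.log (5 / 4) :=
          mul_le_mul_of_nonneg_right hc (Real.log_nonneg (by norm_num))
      _ ≤ (m : ℝ) ^ 2 / 2 * (Real.log 2 / 3) := by gcongr
      _ = _ := by ring
  have h := (hsparse.trans htotal).trans hpow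
  rw [Real.exp_neg, mul_inv_le_iff₀ (Real.exp_pos _), ← Real.exp_add] at h
  refine h.trans_eq ?_
  congr 1
  ring

/-- The graph on `V` whose edges are the pairs in `s`, regarded as unordered. -/
def graphOfPairs {V : Type*} (s : Finset (V × V)) : SimpleGraph V :=
  SimpleGraph.fromRel fun x y => (x, y) ∈ s

/-- Since all pairs point from `A` to its complement, the graph recovers `s`; this gives the
injectivity used in counting. -/
theorem graphOfPairs_adj_iff {V : Type*} [Fintype V] [DecidableEq V] {A : Finset V}
    {s : Finset (V × V)} (hs : s ⊆ A ×ˢ Aᶜ) (x y : V) :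
    (x, y) ∈ s ↔ (x ∈ A ∧ y ∉ A) ∧ (graphOfPairs s).Adj x y := by
  have key : ∀ {x y}, (x, y) ∈ s → x ∈ A ∧ y ∉ A := fun h => by simpa using hs h
  rw [graphOfPairs, SimpleGraph.fromRel_adj]
  constructor
  · intro h
    refine ⟨key h, ?_, Or.inl h⟩
    rintro rfl
    exact (key h).2 (key h).1
  · rintro ⟨⟨hx, -⟩, -, h | h⟩
    · exact h
    · exact absurd hx (key h).2

theorem isBipartite_graphOfPairs {V : Type*} [Fintype V] [DecidableEq V] {A : Finset V}
    {s : Finset (V × V)} (hs : s ⊆ A ×ˢ Aᶜ) : (graphOfPairs s).IsBipartite := by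
  have key : ∀ {x y}, (x, y) ∈ s → x ∈ A ∧ y ∉ A := fun h => by simpa using hs h
  refine ⟨SimpleGraph.Coloring.mk (fun x => if x ∈ A then 0 else 1) ?_⟩
  intro x y hxy
  rw [graphOfPairs, SimpleGraph.fromRel_adj] at hxy
  rcases hxy.2 with h | h <;> simp [key h]

theorem two_pow_le_ncard_isBipartite {V : Type*} [Fintype V] [DecidableEq V] (A : Finset V) :
    2 ^ (A.card * Aᶜ.card) ≤ Set.ncard {G : SimpleGraph V | G.IsBipartite} := by
  have h := Set.ncard_le_ncard_of_injOn (s := ((A ×ˢ Aᶜ).powerset : Finset (Finset (V × V))))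
    (t := {G : SimpleGraph V | G.IsBipartite}) graphOfPairs
    (fun s hs => isBipartite_graphOfPairs (Finset.mem_powerset.1 hs)) ?_
  · rwa [Set.ncard_coe_finset, Finset.card_powerset, Finset.card_product] at h
  · intro s hs s' hs' heq
    ext ⟨x, y⟩
    rw [graphOfPairs_adj_iff (Finset.mem_powerset.1 hs),
      graphOfPairs_adj_iff (Finset.mem_powerset.1 hs'), heq]

theorem exp_le_ncard_isBipartite (m : ℕ) :
    Real.exp (Real.log 2 * (((m : ℝ) ^ 2 - 1) / 4)) ≤
      (Set.ncard {G : SimpleGraph (Fin m) | G.IsBipartite} : ℝ) := by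
  obtain ⟨A, -, hA⟩ := Finset.exists_subset_card_eq
    (s := (Finset.univ : Finset (Fin m))) (n := m / 2) (by simpa using Nat.div_le_self m 2)
  have hAc : Aᶜ.card = m - m / 2 := by rw [Finset.card_compl, hA, Fintype.card_fin]
  have h := two_pow_le_ncard_isBipartite A
  rw [hA, hAc] at h
  have hprod : ((m : ℝ) ^ 2 - 1) / 4 ≤ ((m / 2 * (m - m / 2) : ℕ) : ℝ) := by
    obtain ⟨k, rfl | rfl⟩ := Nat.even_or_odd' m
    · rw [show 2 * k / 2 = k by omega, show 2 * k - k = k by omega]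
      push_cast
      nlinarith
    · rw [show (2 * k + 1) / 2 = k by omega, show 2 * k + 1 - k = k + 1 by omega]
      push_cast
      nlinarith
  calc Real.exp (Real.log 2 * (((m : ℝ) ^ 2 - 1) / 4))
      ≤ Real.exp (((m / 2 * (m - m / 2) : ℕ) : ℝ) * Real.log 2) := by
        rw [Real.exp_le_exp, mul_comm]
        exact mul_le_mul_of_nonneg_right hprod (Real.log_nonneg one_le_two)
    _ = (2 : ℝ) ^ (m / 2 * (m - m / 2)) := by rw [Real.exp_nat_mul, Real.exp_log two_pos]
    _ ≤ _ := by exact_mod_cast h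

/-! ### Passing to almost all bipartite graphs -/

/-- A property that holds for all graphs on `m` vertices with more than `m ^ 2 / 32` edges, once
`m` is large, holds for almost all bipartite graphs. -/
theorem tendsto_bipartiteProb_one {P : (m : ℕ) → SimpleGraph (Fin m) → Prop}
    (hP : ∀ᶠ m : ℕ in atTop, ∀ G : SimpleGraph (Fin m),
      (m : ℝ) ^ 2 / 32 < (G.edgeSet.ncard : ℝ) → P m G) :
    Tendsto (fun m => bipartiteProb m (P m)) atTop (𝓝 1) := by
  have hlog2 : 0 < Real.log 2 := Real.log_pos one_lt_two
  have hpos : ∀ m : ℕ, (0 : ℝ) < (Set.ncard {G : SimpleGraph (Fin m) | G.IsBipartite} : ℝ) :=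
    fun m => (Real.exp_pos _).trans_le (exp_le_ncard_isBipartite m)
  -- The exponent is `11m²/48 - (m²-1)/4`, so it bounds the proportion of sparse graphs.
  have hzero : Tendsto (fun m : ℕ => 1 - Real.exp (Real.log 2 * (1 / 4 - (m : ℝ) ^ 2 / 48)))
      atTop (𝓝 1) := by
    have hsq : Tendsto (fun m : ℕ => (m : ℝ) ^ 2 / 48) atTop atTop :=
      ((tendsto_pow_atTop two_ne_zero).comp tendsto_natCast_atTop_atTop).atTop_div_const
        (by norm_num)
    have := Real.tendsto_exp_atBot.comp
      ((tendsto_atBot_add_const_left atTop (1 / 4 : ℝ)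
        (tendsto_neg_atTop_atBot.comp hsq)).const_mul_atBot hlog2)
    simpa [Function.comp_def, sub_eq_add_neg] using this.const_sub 1
  refine tendsto_of_tendsto_of_tendsto_of_le_of_le' hzero tendsto_const_nhds ?_ ?_
  · filter_upwards [hP] with m hm
    rw [bipartiteProb, le_div_iff₀ (hpos m)]
    have hcover : (Set.ncard {G : SimpleGraph (Fin m) | G.IsBipartite} : ℝ) ≤
        (Set.ncard {G : SimpleGraph (Fin m) | G.IsBipartite ∧ P m G} : ℝ) +
        (Set.ncard {G : SimpleGraph (Fin m) |
          (G.edgeSet.ncard : ℝ) ≤ (m : ℝ) ^ 2 / 32} : ℝ) := by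
      have hsub : {G : SimpleGraph (Fin m) | G.IsBipartite} ⊆
          {G | G.IsBipartite ∧ P m G} ∪ {G | (G.edgeSet.ncard : ℝ) ≤ (m : ℝ) ^ 2 / 32} := by
        intro G hG
        rcases le_or_gt (G.edgeSet.ncard : ℝ) ((m : ℝ) ^ 2 / 32) with h | h
        · exact Or.inr h
        · exact Or.inl ⟨hG, hm G h⟩
      exact_mod_cast (Set.ncard_le_ncard hsub).trans (Set.ncard_union_le _ _)
    have hratio : Real.exp (Real.log 2 * (11 / 48 * (m : ℝ) ^ 2)) ≤
        Real.exp (Real.log 2 * (1 / 4 - (m : ℝ) ^ 2 / 48)) *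
          (Set.ncard {G : SimpleGraph (Fin m) | G.IsBipartite} : ℝ) := by
      refine le_trans (le_of_eq ?_)
        (mul_le_mul_of_nonneg_left (exp_le_ncard_isBipartite m) (Real.exp_pos _).le)
      rw [← Real.exp_add]
      congr 1
      ring
    linarith [ncard_sparse_le m]
  · refine Eventually.of_forall fun m => div_le_one_of_le₀ ?_ (hpos m).le
    have hsub : {G : SimpleGraph (Fin m) | G.IsBipartite ∧ P m G} ⊆ {G | G.IsBipartite} :=
      fun G hG => hG.1
    exact_mod_cast Set.ncard_le_ncard hsub

theorem mul_sqrt_le_of_le {m : ℕ} (hm : 1024 ≤ m) :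
    (m : ℝ) * Real.sqrt ((m : ℝ) - 1) ≤ (m : ℝ) ^ 2 / 32 := by
  have hm' : (1024 : ℝ) ≤ m := by exact_mod_cast hm
  have h : Real.sqrt ((m : ℝ) - 1) ≤ (m : ℝ) / 32 := by
    rw [Real.sqrt_le_left (by positivity)]
    nlinarith
  nlinarith

theorem eventually_not_isAntiCommon : ∀ᶠ m : ℕ in atTop, ∀ G : SimpleGraph (Fin m),
    (m : ℝ) ^ 2 / 32 < (G.edgeSet.ncard : ℝ) → ¬ IsAntiCommon G := by
  -- Any constant below `1/4096` would do: `2m³ log m` must stay below `m⁴/2048`.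
  have hlog : ∀ᶠ m : ℕ in atTop, Real.log m ≤ (1 / 8192 : ℝ) * m := by
    have h := (Real.isLittleO_log_id_atTop.comp_tendsto tendsto_natCast_atTop_atTop).bound
      (show (0 : ℝ) < 1 / 8192 by norm_num)
    filter_upwards [h] with m hm
    simpa using (le_abs_self _).trans hm
  filter_upwards [hlog, eventually_ge_atTop 1024] with m hm hm1 G hG
  have hm' : (1024 : ℝ) ≤ m := by exact_mod_cast hm1
  refine not_isAntiCommon_of_lt (by omega) G ?_
  have hm0 : (0 : ℝ) < m := by linarith
  have hsq : (1024 : ℝ) ≤ (m : ℝ) ^ 2 := by nlinarith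
  calc (m : ℝ) ^ 2 * ((m : ℝ) + 1) * Real.log m
      ≤ (m : ℝ) ^ 2 * ((m : ℝ) + m) * (1 / 8192 * m) := by
        gcongr
        linarith
    _ < (m : ℝ) ^ 2 / 32 * ((m : ℝ) ^ 2 / 64) := by
        have : (0 : ℝ) < (m : ℝ) ^ 4 := by positivity
        linarith
    _ ≤ (G.edgeSet.ncard : ℝ) * ((G.edgeSet.ncard : ℝ) - 1) := by
        apply mul_le_mul <;> linarith

end AntiRamsey

theorem mainTheorem5 :
    Tendsto (fun m : ℕ => AntiRamsey.bipartiteProb m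
      (fun G => (m : ℝ) * Real.sqrt ((m : ℝ) - 1) < (G.edgeSet.ncard : ℝ))) atTop (𝓝 1) ∧
    Tendsto (fun m : ℕ => AntiRamsey.bipartiteProb m
      (fun G => ¬ AntiRamsey.IsAntiCommon G)) atTop (𝓝 1) := by
  refine ⟨AntiRamsey.tendsto_bipartiteProb_one ?_,
    AntiRamsey.tendsto_bipartiteProb_one AntiRamsey.eventually_not_isAntiCommon⟩
  filter_upwards [eventually_ge_atTop 1024] with m hm G hG
  exact (AntiRamsey.mul_sqrt_le_of_le hm).trans_lt hG
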